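/- Let $\mathbb N=\{0,1,2,\dots\}$, with the convention $\ln 0:=0$. There are a real univariate polynomial $p$ and, for every $m\in\mathbb N$, every $B\in\mathbb N$ and every $x\in\mathbb R^2$, a deterministic adaptive procedure $A_{m,B,x}$ with the following properties. The procedure has access to functions $f:\mathbb R^2\to\mathbb R$ and $g_1,\dots,g_m:\mathbb R^2\to\mathbb R$ only by evaluating them one at a time: in each step it chooses one of these functions and a point of $\mathbb R^2$, depending only on $m,B,x$ and on the values received so far, and receives the exact value of that function at that point; or it stops, and outputs either a point of $\mathbb Z^2$ or the message ``there is no such point''. Whenever $f,g_1,\dots,g_m:\mathbb R^2\to\mathbb R$ are convex and $x\in[-B,B]^2$ satisfies $g_i(x)\le 0$ for all $i=1,\dots,m$, the procedure $A_{m,B,x}$ run on $f,g_1,\dots,g_m$ evaluates $f$ at most $p(\ln B)$ times, evaluates each $g_i$ at most $p(\ln B)$ times, and either (a) outputs a point $\hat x\in[-B,B]^2\cap\mathbb Z^2$ with $f(\hat x)\le f(x)$ and $g_i(\hat x)\le 0$ for all $i=1,\dots,m$, or (b) outputs the message ``there is no such point'', and then no point $\hat x$ as in (a) exists. In particular $p$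 does not depend on $m$, $B$, $x$, $f$ or $g_1,\dots,g_m$. -/

import Mathlib

namespace EvalOracle

/-- A deterministic adaptive procedure with access to unknown functions `f, g₁, …, g_m : ℝ² → ℝ`
only through their values. It either stops with an output, or chooses one of the functions and a
point of `ℝ²`, receives the value of that function at that point, and continues in a way that
depends on the value received.

The output `some z` is an integer point; the output `none` is the assertion that there is no
integer point of the kind that is looked for. -/
inductive Procedure (m : ℕ) : Type
  | answer (out : Option (Fin 2 → ℤ)) : Procedure m
  | evalF (y : Fin 2 → ℝ) (next : ℝ → Procedure m) : Procedure m
  | evalG (i : Fin m) (y : Fin 2 → ℝ) (next : ℝ → Procedure m) : Procedure m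

namespace Procedure

/-- The output of the procedure when it is run on the functions `f` and `g`. -/
def output {m : ℕ} (f : (Fin 2 → ℝ) → ℝ) (g : Fin m → (Fin 2 → ℝ) → ℝ) :
    Procedure m → Option (Fin 2 → ℤ)
  | answer out => out
  | evalF y next => output f g (next (f y))
  | evalG i y next => output f g (next (g i y))

/-- The number of evaluations of `f` made in the run on the functions `f` and `g`. -/
def countF {m : ℕ} (f : (Fin 2 → ℝ) → ℝ) (g : Fin m → (Fin 2 → ℝ) → ℝ) :
    Procedure m → ℕ
  | answer _ => 0
  | evalF y next => countF f g (next (f y)) + 1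
  | evalG i y next => countF f g (next (g i y))

/-- The number of evaluations of `g i` made in the run on the functions `f` and `g`. -/
def countG {m : ℕ} (f : (Fin 2 → ℝ) → ℝ) (g : Fin m → (Fin 2 → ℝ) → ℝ) (i : Fin m) :
    Procedure m → ℕ
  | answer _ => 0
  | evalF y next => countG f g i (next (f y))
  | evalG k y next => countG f g i (next (g k y)) + (if k = i then 1 else 0)

end Procedure

/-- `z` is an integer point of `[-B, B]²` with `f z ≤ f x` and `g i z ≤ 0` for all `i`. -/
def IsImproving {m : ℕ} (f : (Fin 2 → ℝ) → ℝ) (g : Fin m → (Fin 2 → ℝ) → ℝ) (B : ℕ)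
    (x : Fin 2 → ℝ) (z : Fin 2 → ℤ) : Prop :=
  (∀ j, -(B : ℤ) ≤ z j ∧ z j ≤ (B : ℤ)) ∧
    f (fun j => (z j : ℝ)) ≤ f x ∧ ∀ i, g i (fun j => (z j : ℝ)) ≤ 0

/-- The output is correct: a returned point is an improving integer point, and `none` is returned
only if there is no improving integer point. -/
def CorrectOutput {m : ℕ} (f : (Fin 2 → ℝ) → ℝ) (g : Fin m → (Fin 2 → ℝ) → ℝ) (B : ℕ)
    (x : Fin 2 → ℝ) : Option (Fin 2 → ℤ) → Prop
  | some z => IsImproving f g B x z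
  | none => ∀ z : Fin 2 → ℤ, ¬ IsImproving f g B x z

end EvalOracle

/-! With `c = f x`, the function `H = max (f - c, g₁, …, g_m)` is convex, `H x ≤ 0`, and the
improving points are the points of the box with `H ≤ 0`. One value of `H` costs one value of `f` and
of each `g i`, so `m` does not enter the bound.

A set `S` of surviving candidates is cut down in rounds. By `exists_integer_centerpoint` some `z ∈
S` has a quarter of `S` in every closed half-plane through it. If `H z ≤ 0`, the search ends.
Otherwise some line through `z` has `H > 0` on one closed side. Without subgradients, its slope is
found by bisection: comparing `H` near `z` with `H z` excludes points by convexity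
(`pos_of_probe_lt`, `pos_of_le_probe`), and only the finitely many slopes of points of `S` matter.
There are `O(log B)` rounds of `O(log B)` evaluations each. -/

namespace EvalOracle

/-! ### Integer centerpoints -/

/-- A set of integer points that contains every integral midpoint of two of its points. -/
def MidClosed (S : Finset (Fin 2 → ℤ)) : Prop :=
  ∀ a ∈ S, ∀ b ∈ S, ∀ c : Fin 2 → ℤ, (∀ j, a j + b j = 2 * c j) → c ∈ S

/-- The linear form with coefficients `s`, at an integer point. -/
def lin (s : Fin 2 → ℝ) (w : Fin 2 → ℤ) : ℝ := s 0 * w 0 + s 1 * w 1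

/-- The points of `S` in the closed half-plane `b ≤ s`. -/
noncomputable def cap (S : Finset (Fin 2 → ℤ)) (s : Fin 2 → ℝ) (b : ℝ) : Finset (Fin 2 → ℤ) :=
  S.filter fun w => b ≤ lin s w

theorem mem_cap {S : Finset (Fin 2 → ℤ)} {s : Fin 2 → ℝ} {b : ℝ} {w : Fin 2 → ℤ} :
    w ∈ cap S s b ↔ w ∈ S ∧ b ≤ lin s w := by simp [cap]

theorem lin_midpoint {a b c : Fin 2 → ℤ} (h : ∀ j, a j + b j = 2 * c j) (s : Fin 2 → ℝ) :
    lin s a + lin s b = 2 * lin s c := by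
  have h0 : (a 0 : ℝ) + b 0 = 2 * c 0 := by exact_mod_cast h 0
  have h1 : (a 1 : ℝ) + b 1 = 2 * c 1 := by exact_mod_cast h 1
  unfold lin
  linear_combination s 0 * h0 + s 1 * h1

theorem MidClosed.filter_lt {S : Finset (Fin 2 → ℤ)} (hS : MidClosed S) (s : Fin 2 → ℝ) (b : ℝ) :
    MidClosed (S.filter fun w => lin s w < b) := by
  intro u hu v hv c hc
  rw [Finset.mem_filter] at *
  have := lin_midpoint hc s
  exact ⟨hS u hu.1 v hv.1 c hc, by linarith⟩

/-- Raising the threshold past the lowest level `b₀` of a nonempty cap removes exactly the points on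
that level. -/
theorem exists_smaller_cap {S : Finset (Fin 2 → ℤ)} {s : Fin 2 → ℝ} {b : ℝ}
    (hne : (cap S s b).Nonempty) :
    ∃ (b₀ b₁ : ℝ), b ≤ b₀ ∧ (∀ w ∈ cap S s b, b₀ ≤ lin s w) ∧ cap S s b₁ ⊂ cap S s b ∧
      ∀ w ∈ cap S s b, w ∉ cap S s b₁ → lin s w = b₀ := by
  obtain ⟨u, hu, hmin⟩ := Finset.exists_min_image _ (lin s) hne
  by_cases hT : ((cap S s b).filter fun w => lin s u < lin s w).Nonempty
  · obtain ⟨v, hv, hvmin⟩ := Finset.exists_min_image _ (lin s) hT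
    rw [Finset.mem_filter] at hv
    refine ⟨lin s u, lin s v, (mem_cap.1 hu).2, hmin, ?_, ?_⟩
    · rw [Finset.ssubset_iff_of_subset]
      · exact ⟨u, hu, fun h => absurd (mem_cap.1 h).2 (not_le.2 hv.2)⟩
      · intro w hw
        exact mem_cap.2 ⟨(mem_cap.1 hw).1, (mem_cap.1 hv.1).2.trans (mem_cap.1 hw).2⟩
    · intro w hw hw'
      by_contra hne'
      have hlt := lt_of_le_of_ne (hmin w hw) (Ne.symm hne')
      exact hw' (mem_cap.2 ⟨(mem_cap.1 hw).1, hvmin w (Finset.mem_filter.2 ⟨hw, hlt⟩)⟩)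
  · rw [Finset.not_nonempty_iff_eq_empty, Finset.filter_eq_empty_iff] at hT
    refine ⟨lin s u, lin s u + 1, (mem_cap.1 hu).2, hmin, ?_, ?_⟩
    · rw [Finset.ssubset_iff_of_subset]
      · exact ⟨u, hu, fun h => by linarith [(mem_cap.1 h).2]⟩
      · intro w hw
        exact mem_cap.2 ⟨(mem_cap.1 hw).1, by linarith [(mem_cap.1 hw).2, (mem_cap.1 hu).2]⟩
    · intro w hw _
      exact le_antisymm (not_lt.1 (hT hw)) (hmin w hw)

/-- A finite set of integer points that cannot be separated from its integral midpoints has a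
point such that every half-plane through it contains a quarter of the set. -/
theorem exists_integer_centerpoint {S : Finset (Fin 2 → ℤ)} (hS : MidClosed S)
    (hne : S.Nonempty) : ∃ z ∈ S, ∀ s : Fin 2 → ℝ, S.card ≤ 4 * (cap S s (lin s z)).card := by
  classical
  by_contra! hcon
  -- If no centerpoint exists, the caps with less than a quarter of `S` cover `S`.
  let light : Finset (Finset (Fin 2 → ℤ)) :=
    S.powerset.filter fun D => (∃ s b, D = cap S s b) ∧ 4 * D.card < S.card
  let covers : Finset (Finset (Finset (Fin 2 → ℤ))) :=
    light.powerset.filter fun 𝒟 => ∀ w ∈ S, ∃ D ∈ 𝒟, w ∈ D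
  have hcov : covers.Nonempty := by
    refine ⟨light, Finset.mem_filter.2 ⟨Finset.mem_powerset_self _, fun w hw => ?_⟩⟩
    obtain ⟨s, hs⟩ := hcon w hw
    exact ⟨cap S s (lin s w), Finset.mem_filter.2 ⟨Finset.mem_powerset.2 (Finset.filter_subset _ _),
      ⟨_, _, rfl⟩, hs⟩, mem_cap.2 ⟨hw, le_rfl⟩⟩
  -- The `+ 1` makes dropping an empty cap a strict improvement.
  obtain ⟨𝒟, h𝒟, hmin⟩ := Finset.exists_min_image covers (fun 𝒟 => ∑ D ∈ 𝒟, (D.card + 1)) hcov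
  obtain ⟨hsub, hcover⟩ := Finset.mem_filter.1 h𝒟
  rw [Finset.mem_powerset] at hsub
  -- By minimality each cap has a private point `a` on its lowest level; otherwise that level could
  -- be dropped.
  have key : ∀ D ∈ 𝒟, ∃ (s : Fin 2 → ℝ) (b b₀ : ℝ) (a : Fin 2 → ℤ), D = cap S s b ∧ b ≤ b₀ ∧
      (∀ w ∈ D, b₀ ≤ lin s w) ∧ lin s a = b₀ ∧ a ∈ S ∧ ∀ E ∈ 𝒟, a ∈ E → E = D := by
    intro D hD
    obtain ⟨-, ⟨s, b, rfl⟩, hlight⟩ := Finset.mem_filter.1 (hsub hD)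
    have hDne : (cap S s b).Nonempty := by
      by_contra hemp
      rw [Finset.not_nonempty_iff_eq_empty] at hemp
      have hc : 𝒟.erase (cap S s b) ∈ covers := by
        refine Finset.mem_filter.2 ⟨Finset.mem_powerset.2
          ((Finset.erase_subset _ _).trans hsub), fun w hw => ?_⟩
        obtain ⟨E, hE, hwE⟩ := hcover w hw
        refine ⟨E, Finset.mem_erase.2 ⟨?_, hE⟩, hwE⟩
        rintro rfl
        simp [hemp] at hwE
      have h1 := hmin _ hc
      have h2 := Finset.add_sum_erase 𝒟 (fun D => D.card + 1) hD
      omega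
    obtain ⟨b₀, b₁, hb, hb₀, hss, hlow⟩ := exists_smaller_cap hDne
    by_contra! hno
    have hc : insert (cap S s b₁) (𝒟.erase (cap S s b)) ∈ covers := by
      refine Finset.mem_filter.2 ⟨Finset.mem_powerset.2 (Finset.insert_subset ?_
        ((Finset.erase_subset _ _).trans hsub)), fun w hw => ?_⟩
      · have := Finset.card_lt_card hss
        exact Finset.mem_filter.2 ⟨Finset.mem_powerset.2 (Finset.filter_subset _ _),
          ⟨_, _, rfl⟩, by omega⟩
      · obtain ⟨E, hE, hwE⟩ := hcover w hw
        by_cases hED : E = cap S s b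
        · subst hED
          by_cases hw1 : w ∈ cap S s b₁
          · exact ⟨_, Finset.mem_insert_self _ _, hw1⟩
          · obtain ⟨F, hF, hwF, hFD⟩ := hno s b b₀ w rfl hb hb₀ (hlow w hwE hw1) hw
            exact ⟨F, Finset.mem_insert_of_mem (Finset.mem_erase.2 ⟨hFD, hF⟩), hwF⟩
        · exact ⟨E, Finset.mem_insert_of_mem (Finset.mem_erase.2 ⟨hED, hE⟩), hwE⟩
    have h1 := hmin _ hc
    have h2 := Finset.add_sum_erase 𝒟 (fun D => D.card + 1) hD
    have h3 : ∑ D ∈ insert (cap S s b₁) (𝒟.erase (cap S s b)), (D.card + 1) ≤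
        ((cap S s b₁).card + 1) + ∑ D ∈ 𝒟.erase (cap S s b), (D.card + 1) := by
      by_cases hm : cap S s b₁ ∈ 𝒟.erase (cap S s b)
      · rw [Finset.insert_eq_of_mem hm]
        exact Nat.le_add_left _ _
      · rw [Finset.sum_insert hm]
    have h4 := Finset.card_lt_card hss
    omega
  choose! s b b₀ a hD hb hb₀ ha haS huniq using key
  have hcard : 4 < 𝒟.card := by
    have h1 : S.card ≤ ∑ D ∈ 𝒟, D.card := by
      refine (Finset.card_le_card (t := 𝒟.biUnion id) fun w hw => ?_).trans Finset.card_biUnion_le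
      simpa using hcover w hw
    have h2 : 4 * ∑ D ∈ 𝒟, D.card ≤ ∑ D ∈ 𝒟, (S.card - 1) := by
      rw [Finset.mul_sum]
      refine Finset.sum_le_sum fun D hD => ?_
      have := (Finset.mem_filter.1 (hsub hD)).2.2
      omega
    rw [Finset.sum_const, smul_eq_mul] at h2
    by_contra! h4
    have h5 := Nat.mul_le_mul_right (S.card - 1) h4
    have h6 := hne.card_pos
    omega
  -- There are four parity classes and more than four caps, so two private points have an integral
  -- midpoint.
  obtain ⟨D, hD𝒟, E, hE𝒟, hDE, hpar⟩ :=
    Finset.exists_ne_map_eq_of_card_lt_of_maps_to (s := 𝒟)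
      (t := (Finset.univ : Finset (Fin 2 → ZMod 2))) (by simpa using hcard)
      (f := fun D j => (a D j : ZMod 2)) (fun _ _ => Finset.mem_univ _)
  have hmid : ∀ j, ∃ c : ℤ, a D j + a E j = 2 * c := by
    intro j
    have h1 : (2 : ℤ) ∣ a D j - a E j := by
      have := (ZMod.intCast_eq_intCast_iff_dvd_sub (a E j) (a D j) 2).1 (congrFun hpar j).symm
      exact_mod_cast this
    obtain ⟨c, hc⟩ := h1
    exact ⟨c + a E j, by linarith⟩
  choose c hc using hmid
  have hcS : c ∈ S := hS _ (haS D hD𝒟) _ (haS E hE𝒟) c hc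
  obtain ⟨F, hF𝒟, hcF⟩ := hcover c hcS
  have hlow : ∀ G ∈ 𝒟, F ≠ G → lin (s F) (a G) < b F := by
    intro G hG hFG
    by_contra! hle
    refine hFG (huniq G hG F hF𝒟 ?_)
    rw [hD F hF𝒟]
    exact mem_cap.2 ⟨haS G hG, hle⟩
  have hlow' : ∀ G ∈ 𝒟, lin (s F) (a G) ≤ b₀ F := by
    intro G hG
    by_cases hFG : F = G
    · rw [← hFG, ha F hF𝒟]
    · exact (hlow G hG hFG).le.trans (hb F hF𝒟)
  have hlt := hlow' D hD𝒟
  have hlt' := hlow' E hE𝒟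
  have hm := lin_midpoint hc (s F)
  have hcF' := hb₀ F hF𝒟 c hcF
  -- At least one of `D`, `E` is not `F`, and its private point lies strictly below `F`; so the
  -- midpoint lies below the lowest level of `F`.
  by_cases hFD : F = D
  · have := hlow E hE𝒟 (hFD ▸ hDE)
    have := hb F hF𝒟
    linarith
  · have := hlow D hD𝒟 hFD
    have := hb F hF𝒟
    linarith

/-! ### Adaptive evaluation of a single function -/

/-- The real point with the coordinates of an integer point. -/
def toReal (z : Fin 2 → ℤ) : Fin 2 → ℝ := fun j => (z j : ℝ)

/-- `out` is right for `H` on the set `T` of candidates: it names a candidate at which `H` is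
nonpositive, or there is no such candidate. -/
def Right (T : Finset (Fin 2 → ℤ)) (H : (Fin 2 → ℝ) → ℝ) : Option (Fin 2 → ℤ) → Prop
  | some z => z ∈ T ∧ H (toReal z) ≤ 0
  | none => ∀ z ∈ T, ¬ H (toReal z) ≤ 0

/-- Adaptive evaluation at `n` points is enough to find a right answer for each `H ∈ 𝓗`. -/
def Solves (T : Finset (Fin 2 → ℤ)) : ℕ → Set ((Fin 2 → ℝ) → ℝ) → Prop
  | 0, 𝓗 => ∃ out, ∀ H ∈ 𝓗, Right T H out
  | n + 1, 𝓗 => ∃ y, ∀ v, Solves T n {H ∈ 𝓗 | H y = v}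

theorem Solves.mono {T : Finset (Fin 2 → ℤ)} {n : ℕ} {𝓗 𝓗' : Set ((Fin 2 → ℝ) → ℝ)}
    (h : Solves T n 𝓗) (hsub : 𝓗' ⊆ 𝓗) : Solves T n 𝓗' := by
  induction n generalizing 𝓗 𝓗' with
  | zero =>
    obtain ⟨out, ho⟩ := h
    exact ⟨out, fun H hH => ho H (hsub hH)⟩
  | succ n ih =>
    obtain ⟨y, hy⟩ := h
    exact ⟨y, fun v => ih (hy v) fun H hH => ⟨hsub hH.1, hH.2⟩⟩

theorem solves_of_answer {T : Finset (Fin 2 → ℤ)} (n : ℕ) {𝓗 : Set ((Fin 2 → ℝ) → ℝ)}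
    (out : Option (Fin 2 → ℤ)) (h : ∀ H ∈ 𝓗, Right T H out) : Solves T n 𝓗 := by
  induction n generalizing 𝓗 with
  | zero => exact ⟨out, h⟩
  | succ n ih => exact ⟨0, fun v => ih fun H hH => h H hH.1⟩

/-! ### Exclusion of points by convexity -/

theorem three_point_jensen {H : (Fin 2 → ℝ) → ℝ} (hH : ConvexOn ℝ Set.univ H)
    {p u v w : Fin 2 → ℝ} {a b c : ℝ} (ha : 0 ≤ a) (hb : 0 ≤ b) (hc : 0 ≤ c)
    (habc : 0 < a + b + c) (h : ∀ j, (a + b + c) * p j = a * u j + b * v j + c * w j) :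
    (a + b + c) * H p ≤ a * H u + b * H v + c * H w := by
  have hJ := hH.map_sum_le (t := (Finset.univ : Finset (Fin 3)))
    (w := ![a / (a + b + c), b / (a + b + c), c / (a + b + c)]) (p := ![u, v, w])
    (by intro i _; fin_cases i <;> simp <;> positivity)
    (by simp [Fin.sum_univ_three]; field_simp) (fun _ _ => Set.mem_univ _)
  simp only [Fin.sum_univ_three, Matrix.cons_val_zero, Matrix.cons_val_one, Matrix.cons_val,
    smul_eq_mul] at hJ
  have hp : (a / (a + b + c)) • u + (b / (a + b + c)) • v + (c / (a + b + c)) • w = p := by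
    ext j
    simp only [Pi.add_apply, Pi.smul_apply, smul_eq_mul]
    have := h j
    field_simp
    linarith
  rw [hp] at hJ
  calc (a + b + c) * H p ≤ (a + b + c) * (a / (a + b + c) * H u + b / (a + b + c) * H v +
        c / (a + b + c) * H w) := by gcongr
    _ = _ := by field_simp

/-- The functions that may still be the unknown one when the points of `T` outside `S` have been
discarded. -/
def Candidates (T S : Finset (Fin 2 → ℤ)) (x : Fin 2 → ℝ) : Set ((Fin 2 → ℝ) → ℝ) :=
  {H | ConvexOn ℝ Set.univ H ∧ H x ≤ 0 ∧ ∀ z ∈ T, H (toReal z) ≤ 0 → z ∈ S}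

/-- The coordinate of `w - z` along `z - x`, up to a positive factor. -/
def along (x : Fin 2 → ℝ) (z w : Fin 2 → ℤ) : ℝ :=
  (w 0 - z 0) * (z 0 - x 0) + (w 1 - z 1) * (z 1 - x 1)

/-- The coordinate of `w - z` along the rotation of `z - x` by a right angle, up to the same
factor as in `along`. -/
def across (x : Fin 2 → ℝ) (z w : Fin 2 → ℤ) : ℝ :=
  (w 1 - z 1) * (z 0 - x 0) - (w 0 - z 0) * (z 1 - x 1)

/-- The point `z + t (τ e + e')` where `e = z - x` and `e'` is `e` turned by a right angle. -/
def probe (x : Fin 2 → ℝ) (z : Fin 2 → ℤ) (t τ : ℝ) : Fin 2 → ℝ :=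
  ![z 0 + t * (τ * (z 0 - x 0) - (z 1 - x 1)), z 1 + t * (τ * (z 1 - x 1) + (z 0 - x 0))]

section Cut

variable {x : Fin 2 → ℝ} {z w : Fin 2 → ℤ} {H : (Fin 2 → ℝ) → ℝ}

theorem sq_dist_pos (hx : H x ≤ 0) (hz : 0 < H (toReal z)) :
    0 < (z 0 - x 0) ^ 2 + (z 1 - x 1) ^ 2 := by
  by_contra! h
  have h0 : (z 0 : ℝ) - x 0 = 0 := by nlinarith [sq_nonneg (z 0 - x 0), sq_nonneg (z 1 - x 1)]
  have h1 : (z 1 : ℝ) - x 1 = 0 := by nlinarith [sq_nonneg (z 0 - x 0), sq_nonneg (z 1 - x 1)]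
  have : toReal z = x := by
    ext j
    fin_cases j
    · simpa [toReal] using sub_eq_zero.1 h0
    · simpa [toReal] using sub_eq_zero.1 h1
  rw [this] at hz
  linarith

/-- Here `z` lies on the segment from `x` to `w`. -/
theorem pos_of_behind (hH : ConvexOn ℝ Set.univ H) (hx : H x ≤ 0) (hz : 0 < H (toReal z))
    (hw : across x z w = 0) (hw' : 0 ≤ along x z w) : 0 < H (toReal w) := by
  have hq := sq_dist_pos hx hz
  set q := (z 0 - x 0) ^ 2 + (z 1 - x 1) ^ 2
  have := three_point_jensen hH (p := toReal z) (u := toReal w) (v := x) (w := x) hq.le hw' le_rfl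
    (by linarith) (by
      unfold along across at *
      intro j
      fin_cases j <;> simp [toReal]
      · linear_combination (z 1 - x 1) * hw
      · linear_combination -(z 0 - x 0) * hw)
  nlinarith

/-- Here `z` is a convex combination of `w`, the probe and `x`. Since the probe and `x` have values
below `H z`, the value at `w` must be positive. -/
theorem pos_of_probe_lt (hH : ConvexOn ℝ Set.univ H) (hx : H x ≤ 0) (hz : 0 < H (toReal z))
    {t τ : ℝ} (ht : 0 < t) (hy : H (probe x z t τ) < H (toReal z)) (hw : across x z w < 0)
    (hw' : τ * across x z w ≤ along x z w) : 0 < H (toReal w) := by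
  have hq := sq_dist_pos hx hz
  set q := (z 0 - x 0) ^ 2 + (z 1 - x 1) ^ 2
  have h1 : 0 ≤ t * q := by positivity
  have h2 : 0 < -across x z w := by linarith
  have h3 : 0 ≤ t * (along x z w - τ * across x z w) := mul_nonneg ht.le (by linarith)
  have := three_point_jensen hH (p := toReal z) (u := toReal w) (v := probe x z t τ) (w := x)
    h1 h2.le h3 (by linarith) (by
      unfold along across at *
      intro j
      fin_cases j <;> simp [toReal, probe, q] <;> ring)
  have h4 : 0 < t * q := by positivity
  nlinarith [mul_pos h2 (sub_pos.2 hy), mul_pos h4 hz, mul_nonneg h3 hz.le,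
    mul_nonneg h3 (neg_nonneg.2 hx)]

/-- Here the probe is a convex combination of `w`, `z` and `x`; `htw` says that the weight of `z` is
nonnegative. -/
theorem pos_of_le_probe (hH : ConvexOn ℝ Set.univ H) (hx : H x ≤ 0) (hz : 0 < H (toReal z))
    {t τ : ℝ} (ht : 0 < t) (hy : H (toReal z) ≤ H (probe x z t τ)) (hw : 0 < across x z w)
    (hw' : τ * across x z w ≤ along x z w)
    (htw : t * ((z 0 - x 0) ^ 2 + (z 1 - x 1) ^ 2 + (along x z w - τ * across x z w)) ≤
      across x z w) : 0 < H (toReal w) := by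
  have hq := sq_dist_pos hx hz
  set q := (z 0 - x 0) ^ 2 + (z 1 - x 1) ^ 2
  have h1 : 0 < t * q := by positivity
  have h3 : 0 ≤ t * (along x z w - τ * across x z w) := mul_nonneg ht.le (by linarith)
  have := three_point_jensen hH (p := probe x z t τ) (u := toReal w) (v := toReal z) (w := x)
    h1.le (sub_nonneg.2 htw) h3 (by nlinarith) (by
      unfold along across at *
      intro j
      fin_cases j <;> simp [toReal, probe, q] <;> ring)
  have e : t * q + (across x z w - t * (q + (along x z w - τ * across x z w))) +
    t * (along x z w - τ * across x z w) = across x z w := by ring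
  rw [e] at this
  have h5 := mul_le_mul_of_nonneg_left hy hw.le
  have h6 := mul_nonneg h3 (neg_nonneg.2 hx)
  have h7 := mul_nonneg h3 hz.le
  have h8 := mul_pos h1 hz
  by_contra! hneg
  nlinarith [mul_nonneg h1.le (neg_nonneg.2 hneg)]

end Cut

/-! ### Bisection on the slope -/

theorem exists_median (F : Finset ℝ) {j : ℕ} (hF : F.card < 2 ^ (j + 1)) (hne : F.Nonempty) :
    ∃ τ ∈ F, (F.filter (· < τ)).card < 2 ^ j ∧ (F.filter (τ < ·)).card < 2 ^ j := by
  by_cases hj : F.card < 2 ^ j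
  · obtain ⟨τ, hτ⟩ := hne
    exact ⟨τ, hτ, (Finset.card_filter_le _ _).trans_lt hj, (Finset.card_filter_le _ _).trans_lt hj⟩
  push Not at hj
  have hG : (F.filter fun τ => 2 ^ j ≤ (F.filter (· ≤ τ)).card).Nonempty := by
    obtain ⟨M, hM, hmax⟩ := Finset.exists_max_image F id hne
    refine ⟨M, Finset.mem_filter.2 ⟨hM, ?_⟩⟩
    rwa [Finset.filter_true_of_mem (p := (· ≤ M)) fun σ hσ => hmax σ hσ]
  obtain ⟨τ, hτ, hmin⟩ := Finset.exists_min_image _ id hG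
  rw [Finset.mem_filter] at hτ
  refine ⟨τ, hτ.1, ?_, ?_⟩
  · by_contra! hge
    have hne' : (F.filter (· < τ)).Nonempty := by
      rw [← Finset.card_pos]
      exact lt_of_lt_of_le (by positivity) hge
    obtain ⟨σ, hσ, hmax⟩ := Finset.exists_max_image _ id hne'
    rw [Finset.mem_filter] at hσ
    have := hmin σ (Finset.mem_filter.2 ⟨hσ.1, hge.trans (Finset.card_le_card fun ρ hρ => ?_)⟩)
    · exact absurd hσ.2 (not_lt.2 this)
    · exact Finset.mem_filter.2 ⟨(Finset.mem_filter.1 hρ).1, hmax ρ hρ⟩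
  · have h1 := Finset.card_filter_add_card_filter_not (s := F) (· ≤ τ)
    simp only [not_le] at h1
    have h2 := hτ.2
    rw [pow_succ] at hF
    omega

/-- The slopes at which a line through `z` meets a point of `S`. -/
noncomputable def slopes (S : Finset (Fin 2 → ℤ)) (x : Fin 2 → ℝ) (z : Fin 2 → ℤ) : Finset ℝ :=
  S.image fun w => along x z w / across x z w

/-- The left side tends to `0` with `t` and `S` is finite, so one small `t` serves all `w`, as
`pos_of_le_probe` needs. -/
theorem exists_probe_length (S : Finset (Fin 2 → ℤ)) (x : Fin 2 → ℝ) (z : Fin 2 → ℤ) (τ : ℝ) :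
    ∃ t : ℝ, 0 < t ∧ ∀ w ∈ S, 0 < across x z w →
      t * ((z 0 - x 0) ^ 2 + (z 1 - x 1) ^ 2 + (along x z w - τ * across x z w)) ≤
        across x z w := by
  have h : ∀ w ∈ S, ∀ᶠ t : ℝ in nhdsWithin 0 (Set.Ioi 0), 0 < across x z w →
      t * ((z 0 - x 0) ^ 2 + (z 1 - x 1) ^ 2 + (along x z w - τ * across x z w)) ≤
        across x z w := by
    intro w _
    by_cases hw : 0 < across x z w
    · have hc : Filter.Tendsto (fun t : ℝ => t * ((z 0 - x 0) ^ 2 + (z 1 - x 1) ^ 2 +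
          (along x z w - τ * across x z w))) (nhds 0) (nhds 0) := by
        refine (Continuous.tendsto' (by fun_prop) _ _ (by simp))
      filter_upwards [(hc.mono_left nhdsWithin_le_nhds).eventually_lt_const hw] with t ht _
      exact ht.le
    · exact Filter.Eventually.of_forall fun t h => absurd h hw
  have h2 := (Filter.eventually_all_finset S).2 h
  obtain ⟨t, ht, ht'⟩ := (h2.and self_mem_nhdsWithin).exists
  exact ⟨t, ht', ht⟩

theorem lin_sub_eq (x : Fin 2 → ℝ) (z w : Fin 2 → ℤ) (τ : ℝ) :
    lin ![z 0 - x 0 + τ * (z 1 - x 1), z 1 - x 1 - τ * (z 0 - x 0)] w -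
      lin ![z 0 - x 0 + τ * (z 1 - x 1), z 1 - x 1 - τ * (z 0 - x 0)] z =
      along x z w - τ * across x z w := by
  simp [lin, along, across]
  ring

/-- The interval `(a, b)` contains the undecided slopes. A probe at their median replaces `a` or `b`
by `τ`; once no slope is left inside, any `τ` in between gives a half-plane through `z` that can be
discarded. -/
theorem solves_slope_search {T S : Finset (Fin 2 → ℤ)} (hS : MidClosed S)
    {x : Fin 2 → ℝ} {z : Fin 2 → ℤ} {c : ℝ} (hc : 0 < c)
    (hz : ∀ s : Fin 2 → ℝ, S.card ≤ 4 * (cap S s (lin s z)).card) {R : ℕ}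
    (hrec : ∀ S' ⊆ S, MidClosed S' → 4 * S'.card ≤ 3 * S.card → Solves T R (Candidates T S' x))
    (j : ℕ) {a b : ℝ} (hab : a < b)
    (hcard : ((slopes S x z).filter fun τ => a < τ ∧ τ < b).card < 2 ^ j) :
    Solves T (j + R) {H ∈ Candidates T S x | H (toReal z) = c ∧
      (∀ w ∈ S, 0 < across x z w → b * across x z w ≤ along x z w → 0 < H (toReal w)) ∧
      ∀ w ∈ S, across x z w < 0 → a * across x z w ≤ along x z w → 0 < H (toReal w)} := by
  classical
  induction j generalizing a b with
  | zero =>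
    rw [pow_zero, Nat.lt_one_iff, Finset.card_eq_zero, Finset.filter_eq_empty_iff] at hcard
    obtain ⟨τ, haτ, hτb⟩ := exists_between hab
    rw [Nat.zero_add]
    let s : Fin 2 → ℝ := ![z 0 - x 0 + τ * (z 1 - x 1), z 1 - x 1 - τ * (z 0 - x 0)]
    refine (hrec (S.filter fun w => lin s w < lin s z) (Finset.filter_subset _ _)
      (hS.filter_lt _ _) ?_).mono ?_
    · have h1 := Finset.card_filter_add_card_filter_not (s := S) (fun w => lin s w < lin s z)
      have h2 := hz s
      simp only [not_lt] at h1
      unfold cap at h2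
      omega
    · rintro H ⟨⟨hH, hx, hTS⟩, hzc, hp, hn⟩
      have hzpos : 0 < H (toReal z) := hzc ▸ hc
      refine ⟨hH, hx, fun w hwT hw => ?_⟩
      have hwS := hTS w hwT hw
      refine Finset.mem_filter.2 ⟨hwS, ?_⟩
      by_contra! hge
      have hge' : τ * across x z w ≤ along x z w := by
        have := lin_sub_eq x z w τ
        change lin s w - lin s z = _ at this
        linarith
      have hev := hcard (Finset.mem_image_of_mem _ hwS)
      rw [not_and, not_lt] at hev
      refine absurd hw (not_le.2 ?_)
      -- No slope lies in `(a, b)`, so comparison with `τ` decides comparison with an endpoint. On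
      -- `across = 0` the quotient is a default value and is not used.
      rcases lt_trichotomy (across x z w) 0 with h | h | h
      · refine hn w hwS h ?_
        by_contra! hlt
        have h1 : a < along x z w / across x z w := (lt_div_iff_of_neg h).2 hlt
        have h2 := (le_div_iff_of_neg h).1 (hev h1)
        nlinarith
      · exact pos_of_behind hH hx hzpos h (by rw [h, mul_zero] at hge'; exact hge')
      · refine hp w hwS h ?_
        have h1 : a < along x z w / across x z w :=
          haτ.trans_le ((le_div_iff₀ h).2 hge')
        exact (le_div_iff₀ h).1 (hev h1)
  | succ j ih =>
    obtain ⟨τ, haτ, hτb, hl, hr⟩ : ∃ τ, a < τ ∧ τ < b ∧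
        ((slopes S x z).filter fun σ => a < σ ∧ σ < τ).card < 2 ^ j ∧
        ((slopes S x z).filter fun σ => τ < σ ∧ σ < b).card < 2 ^ j := by
      by_cases hne : ((slopes S x z).filter fun τ => a < τ ∧ τ < b).Nonempty
      · obtain ⟨τ, hτ, hl, hr⟩ := exists_median _ hcard hne
        rw [Finset.mem_filter] at hτ
        refine ⟨τ, hτ.2.1, hτ.2.2, lt_of_le_of_lt (Finset.card_le_card fun σ hσ => ?_) hl,
          lt_of_le_of_lt (Finset.card_le_card fun σ hσ => ?_) hr⟩
        · simp only [Finset.mem_filter] at hσ ⊢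
          exact ⟨⟨hσ.1, hσ.2.1, hσ.2.2.trans hτ.2.2⟩, hσ.2.2⟩
        · simp only [Finset.mem_filter] at hσ ⊢
          exact ⟨⟨hσ.1, hτ.2.1.trans hσ.2.1, hσ.2.2⟩, hσ.2.1⟩
      · obtain ⟨τ, haτ, hτb⟩ := exists_between hab
        rw [Finset.not_nonempty_iff_eq_empty, Finset.filter_eq_empty_iff] at hne
        refine ⟨τ, haτ, hτb, ?_, ?_⟩
        · rw [Finset.filter_false_of_mem fun σ hσ h => hne hσ ⟨h.1, h.2.trans hτb⟩]
          simp
        · rw [Finset.filter_false_of_mem fun σ hσ h => hne hσ ⟨haτ.trans h.1, h.2⟩]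
          simp
    obtain ⟨t, ht, hprobe⟩ := exists_probe_length S x z τ
    rw [Nat.add_right_comm]
    refine ⟨probe x z t τ, fun v => ?_⟩
    rcases lt_or_ge v c with hv | hv
    · refine (ih hτb hr).mono ?_
      rintro H ⟨⟨⟨hH, hx, hTS⟩, hzc, hp, hn⟩, hHv⟩
      refine ⟨⟨hH, hx, hTS⟩, hzc, hp, fun w _ hw hw' => ?_⟩
      exact pos_of_probe_lt hH hx (hzc ▸ hc) ht (by rw [hHv, hzc]; exact hv) hw hw'
    · refine (ih haτ hl).mono ?_
      rintro H ⟨⟨⟨hH, hx, hTS⟩, hzc, hp, hn⟩, hHv⟩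
      refine ⟨⟨hH, hx, hTS⟩, hzc, fun w hwS hw hw' => ?_, hn⟩
      exact pos_of_le_probe hH hx (hzc ▸ hc) ht (by rw [hHv, hzc]; exact hv) hw hw'
        (hprobe w hwS hw)

/-- Discarding a quarter of the candidates costs at most `k + 1` evaluations. -/
theorem solves_of_card_lt {T : Finset (Fin 2 → ℤ)} {k : ℕ} (hT : T.card < 2 ^ k)
    (x : Fin 2 → ℝ) (r : ℕ) {S : Finset (Fin 2 → ℤ)} (hST : S ⊆ T) (hS : MidClosed S)
    (hr : S.card * 3 ^ r < 4 ^ r) : Solves T (r * (k + 1)) (Candidates T S x) := by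
  induction r generalizing S with
  | zero =>
    have : S = ∅ := by simpa using hr
    subst this
    refine solves_of_answer _ none fun H hH z hz hle => ?_
    simpa using hH.2.2 z hz hle
  | succ r ih =>
    rcases S.eq_empty_or_nonempty with rfl | hne
    · refine solves_of_answer _ none fun H hH z hz hle => ?_
      simpa using hH.2.2 z hz hle
    obtain ⟨z, hzS, hz⟩ := exists_integer_centerpoint hS hne
    -- One evaluation at `z` and `k` bisection steps, then the remaining rounds.
    have e : (r + 1) * (k + 1) = (k + r * (k + 1)) + 1 := by ring
    rw [e]
    refine ⟨toReal z, fun c => ?_⟩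
    rcases le_or_gt c 0 with hc | hc
    · exact solves_of_answer _ (some z) fun H hH => ⟨hST hzS, hH.2.trans_le hc⟩
    have hrec : ∀ S' ⊆ S, MidClosed S' → 4 * S'.card ≤ 3 * S.card →
        Solves T (r * (k + 1)) (Candidates T S' x) := by
      intro S' hS' hmid hcard
      refine ih (hS'.trans hST) hmid ?_
      have h1 := Nat.mul_le_mul_right (3 ^ r) hcard
      rw [pow_succ, pow_succ] at hr
      nlinarith
    have hcard : (slopes S x z).card < 2 ^ k :=
      (Finset.card_image_le.trans (Finset.card_le_card hST)).trans_lt hT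
    obtain ⟨b, hb⟩ := (slopes S x z).bddAbove
    obtain ⟨a, ha⟩ := (slopes S x z).bddBelow
    have hmem : ∀ w ∈ S, a ≤ along x z w / across x z w ∧ along x z w / across x z w ≤ b :=
      fun w hw => ⟨ha (Finset.mem_image_of_mem _ hw), hb (Finset.mem_image_of_mem _ hw)⟩
    -- Endpoints strictly beyond all slopes make both exclusion conditions vacuous at the start.
    have hab : a - 1 < b + 1 := by
      have := hmem z hzS
      linarith
    refine (solves_slope_search hS hc hz hrec k hab
      ((Finset.card_filter_le _ _).trans_lt hcard)).mono ?_
    rintro H ⟨hH, hHc⟩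
    refine ⟨hH, hHc, fun w hw hpos hle => ?_, fun w hw hneg hle => ?_⟩
    · have := (le_div_iff₀ hpos).2 hle
      linarith [(hmem w hw).2]
    · have := (div_le_iff_of_neg hneg).2 hle
      linarith [(hmem w hw).1]

/-! ### The box and the number of rounds -/

/-- The integer points of `[-B, B]²`. -/
noncomputable def box (B : ℕ) : Finset (Fin 2 → ℤ) :=
  Fintype.piFinset fun _ => Finset.Icc (-(B : ℤ)) B

theorem mem_box {B : ℕ} {z : Fin 2 → ℤ} : z ∈ box B ↔ ∀ j, -(B : ℤ) ≤ z j ∧ z j ≤ (B : ℤ) := by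
  simp [box]

theorem midClosed_box (B : ℕ) : MidClosed (box B) := by
  intro a ha b hb c hc
  rw [mem_box] at *
  intro j
  have := ha j
  have := hb j
  have := hc j
  omega

theorem card_box (B : ℕ) : (box B).card = (2 * B + 1) ^ 2 := by
  have : ((B : ℤ) + 1 + B).toNat = 2 * B + 1 := by omega
  simp [box, this]

theorem card_box_lt (B : ℕ) : (box B).card < 2 ^ (2 * Nat.log 2 B + 4) := by
  have h := Nat.lt_pow_succ_log_self (b := 2) (by norm_num) B
  rw [card_box]
  calc (2 * B + 1) ^ 2 < (2 * 2 ^ (Nat.log 2 B + 1)) ^ 2 :=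
        Nat.pow_lt_pow_left (by omega) (by norm_num)
    _ = _ := by rw [← pow_succ', ← pow_mul]; congr 1; ring

theorem solves_box (B : ℕ) (x : Fin 2 → ℝ) {k : ℕ} (hk : (box B).card < 2 ^ k) :
    Solves (box B) (3 * k * (k + 1)) {H | ConvexOn ℝ Set.univ H ∧ H x ≤ 0} := by
  refine (solves_of_card_lt hk x (3 * k) Finset.Subset.rfl (midClosed_box B) ?_).mono
    fun H hH => ⟨hH.1, hH.2, fun z hz _ => hz⟩
  -- Three rounds at least halve the count, as `2 * 3 ^ 3 = 54 ≤ 64 = 4 ^ 3`; so `3 * k` rounds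
  -- suffice.
  calc (box B).card * 3 ^ (3 * k) < 2 ^ k * 3 ^ (3 * k) := by gcongr
    _ = 54 ^ k := by rw [pow_mul, ← mul_pow]; norm_num
    _ ≤ 64 ^ k := by gcongr; norm_num
    _ = 4 ^ (3 * k) := by rw [pow_mul]; norm_num

/-! ### Merging objective and constraints -/

/-- The largest of `a` and the values at `y` of the functions `g i` with `i ∈ l`. -/
def maxOver {m : ℕ} (g : Fin m → (Fin 2 → ℝ) → ℝ) (l : List (Fin m)) (a : ℝ)
    (y : Fin 2 → ℝ) : ℝ := l.foldl (fun a i => max a (g i y)) a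

theorem maxOver_le_iff {m : ℕ} (g : Fin m → (Fin 2 → ℝ) → ℝ) (l : List (Fin m)) (a c : ℝ)
    (y : Fin 2 → ℝ) : maxOver g l a y ≤ c ↔ a ≤ c ∧ ∀ i ∈ l, g i y ≤ c := by
  induction l generalizing a with
  | nil => simp [maxOver]
  | cons i l ih =>
    have : maxOver g (i :: l) a y = maxOver g l (max a (g i y)) y := rfl
    rw [this, ih]
    simp [and_assoc]

theorem convexOn_maxOver {m : ℕ} {g : Fin m → (Fin 2 → ℝ) → ℝ}
    (hg : ∀ i, ConvexOn ℝ Set.univ (g i)) (l : List (Fin m)) {h : (Fin 2 → ℝ) → ℝ}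
    (hh : ConvexOn ℝ Set.univ h) : ConvexOn ℝ Set.univ fun y => maxOver g l (h y) y := by
  induction l generalizing h with
  | nil => exact hh
  | cons i l ih => exact ih (hh.sup (hg i))

namespace Procedure

/-- Evaluate the functions `g i` with `i ∈ l` at `y` and continue with the largest of `a` and the
values received. -/
def evalMax {m : ℕ} (y : Fin 2 → ℝ) (next : ℝ → Procedure m) : List (Fin m) → ℝ → Procedure m
  | [], a => next a
  | i :: l, a => evalG i y fun v => evalMax y next l (max a v)

variable {m : ℕ} (f : (Fin 2 → ℝ) → ℝ) (g : Fin m → (Fin 2 → ℝ) → ℝ) (y : Fin 2 → ℝ)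
  (next : ℝ → Procedure m)

theorem output_evalMax (l : List (Fin m)) (a : ℝ) :
    (evalMax y next l a).output f g = (next (maxOver g l a y)).output f g := by
  induction l generalizing a with
  | nil => rfl
  | cons i l ih => exact ih _

theorem countF_evalMax (l : List (Fin m)) (a : ℝ) :
    (evalMax y next l a).countF f g = (next (maxOver g l a y)).countF f g := by
  induction l generalizing a with
  | nil => rfl
  | cons i l ih => exact ih _

theorem countG_evalMax (i : Fin m) (l : List (Fin m)) (a : ℝ) :
    (evalMax y next l a).countG f g i = (next (maxOver g l a y)).countG f g i + l.count i := by
  induction l generalizing a with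
  | nil => rfl
  | cons k l ih =>
    simp only [evalMax, countG, List.count_cons, ih, beq_iff_eq, add_assoc]
    rfl

end Procedure

/-- The convex function that is nonpositive exactly where `f ≤ c` and all `g i ≤ 0`. -/
def excess {m : ℕ} (f : (Fin 2 → ℝ) → ℝ) (g : Fin m → (Fin 2 → ℝ) → ℝ) (c : ℝ)
    (y : Fin 2 → ℝ) : ℝ := maxOver g (List.finRange m) (f y - c) y

theorem excess_nonpos_iff {m : ℕ} (f : (Fin 2 → ℝ) → ℝ) (g : Fin m → (Fin 2 → ℝ) → ℝ) (c : ℝ)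
    (y : Fin 2 → ℝ) : excess f g c y ≤ 0 ↔ f y ≤ c ∧ ∀ i, g i y ≤ 0 := by
  simp [excess, maxOver_le_iff]

theorem convexOn_excess {m : ℕ} {f : (Fin 2 → ℝ) → ℝ} {g : Fin m → (Fin 2 → ℝ) → ℝ}
    (hf : ConvexOn ℝ Set.univ f) (hg : ∀ i, ConvexOn ℝ Set.univ (g i)) (c : ℝ) :
    ConvexOn ℝ Set.univ (excess f g c) := by
  refine convexOn_maxOver hg _ (h := fun y => f y - c) ?_
  exact hf.add_const (-c)

theorem Solves.exists_procedure {T : Finset (Fin 2 → ℤ)} {n : ℕ}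
    {𝓗 : Set ((Fin 2 → ℝ) → ℝ)} (h : Solves T n 𝓗) (m : ℕ) (c : ℝ) :
    ∃ P : Procedure m, ∀ f g, excess f g c ∈ 𝓗 → Right T (excess f g c) (P.output f g) ∧
      P.countF f g ≤ n ∧ ∀ i, P.countG f g i ≤ n := by
  induction n generalizing 𝓗 with
  | zero =>
    obtain ⟨out, ho⟩ := h
    exact ⟨.answer out, fun f g hfg => ⟨ho _ hfg, le_rfl, fun _ => le_rfl⟩⟩
  | succ n ih =>
    obtain ⟨y, hy⟩ := h
    choose P hP using fun v => ih (hy v)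
    refine ⟨.evalF y fun u => .evalMax y P (List.finRange m) (u - c), fun f g hfg => ?_⟩
    obtain ⟨h1, h2, h3⟩ := hP (excess f g c y) f g ⟨hfg, rfl⟩
    refine ⟨?_, ?_, fun i => ?_⟩
    · rw [Procedure.output, Procedure.output_evalMax]
      exact h1
    · rw [Procedure.countF, Procedure.countF_evalMax]
      exact Nat.succ_le_succ h2
    · rw [Procedure.countG, Procedure.countG_evalMax]
      exact Nat.add_le_add (h3 i) (List.nodup_iff_count_le_one.1 (List.nodup_finRange m) i)

theorem exists_improvement_procedure (m B : ℕ) (x : Fin 2 → ℝ) {k : ℕ}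
    (hk : (box B).card < 2 ^ k) :
    ∃ P : Procedure m, ∀ f g, ConvexOn ℝ Set.univ f → (∀ i, ConvexOn ℝ Set.univ (g i)) →
      (∀ i, g i x ≤ 0) → CorrectOutput f g B x (P.output f g) ∧
        P.countF f g ≤ 3 * k * (k + 1) + 1 ∧ ∀ i, P.countG f g i ≤ 3 * k * (k + 1) + 1 := by
  choose P hP using fun c => (solves_box B x hk).exists_procedure m c
  -- The first evaluation supplies the level `c = f x` and accounts for the `+ 1`.
  refine ⟨.evalF x P, fun f g hf hg hx => ?_⟩
  obtain ⟨h1, h2, h3⟩ := hP (f x) f g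
    ⟨convexOn_excess hf hg _, (excess_nonpos_iff f g _ _).2 ⟨le_rfl, hx⟩⟩
  refine ⟨?_, Nat.succ_le_succ h2, fun i => (h3 i).trans (Nat.le_succ _)⟩
  have himp : ∀ z, IsImproving f g B x z ↔ z ∈ box B ∧ excess f g (f x) (toReal z) ≤ 0 := by
    intro z
    rw [mem_box, excess_nonpos_iff]
    rfl
  rw [Procedure.output]
  cases hout : (P (f x)).output f g with
  | some z =>
    rw [hout] at h1
    exact (himp z).2 h1
  | none =>
    rw [hout] at h1
    exact fun z hz => h1 z ((himp z).1 hz).1 ((himp z).1 hz).2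

/-! ### The polynomial bound -/

theorem natLog_two_le (B : ℕ) : (Nat.log 2 B : ℝ) ≤ 2 * Real.log B := by
  rcases Nat.eq_zero_or_pos B with rfl | hB
  · simp
  have h1 : (2 : ℝ) ^ Nat.log 2 B ≤ B := by exact_mod_cast Nat.pow_log_le_self 2 hB.ne'
  have h2 := Real.log_le_log (by positivity) h1
  rw [Real.log_pow] at h2
  have h3 := Real.log_two_gt_d9
  have h4 : (0 : ℝ) ≤ Nat.log 2 B := by positivity
  nlinarith

end EvalOracle

theorem mainTheorem1 :
    ∃ (p : Polynomial ℝ) (A : ∀ m : ℕ, ℕ → (Fin 2 → ℝ) → EvalOracle.Procedure m),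
      ∀ (m B : ℕ) (x : Fin 2 → ℝ) (f : (Fin 2 → ℝ) → ℝ) (g : Fin m → (Fin 2 → ℝ) → ℝ),
        ConvexOn ℝ Set.univ f →
        (∀ i, ConvexOn ℝ Set.univ (g i)) →
        (∀ j, -(B : ℝ) ≤ x j ∧ x j ≤ (B : ℝ)) →
        (∀ i, g i x ≤ 0) →
        EvalOracle.CorrectOutput f g B x ((A m B x).output f g) ∧
        ((A m B x).countF f g : ℝ) ≤ p.eval (Real.log (B : ℝ)) ∧
        ∀ i, ((A m B x).countG f g i : ℝ) ≤ p.eval (Real.log (B : ℝ)) := by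
  choose A hA using fun (m B : ℕ) (x : Fin 2 → ℝ) =>
    EvalOracle.exists_improvement_procedure m B x (EvalOracle.card_box_lt B)
  -- With `k = 2 * Nat.log 2 B + 4 ≤ 4 * L + 4`, where `L = Real.log B`, the bound `3 * k * (k + 1)
  -- + 1` becomes `12 * (L + 1) * (4 * L + 5) + 1`.
  refine ⟨Polynomial.C 12 * (Polynomial.X + 1) * (Polynomial.C 4 * Polynomial.X + Polynomial.C 5) + 1, A,
    fun m B x f g hf hg _ hx => ?_⟩
  obtain ⟨h1, h2, h3⟩ := hA m B x f g hf hg hx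
  have hbound : ∀ N : ℕ, N ≤ 3 * (2 * Nat.log 2 B + 4) * (2 * Nat.log 2 B + 4 + 1) + 1 →
      (N : ℝ) ≤ (Polynomial.C 12 * (Polynomial.X + 1) * (Polynomial.C 4 * Polynomial.X + Polynomial.C 5) +
        1 : Polynomial ℝ).eval (Real.log B) := by
    intro N hN
    have hlog := EvalOracle.natLog_two_le B
    have hN' : (N : ℝ) ≤ 3 * (2 * Nat.log 2 B + 4) * (2 * Nat.log 2 B + 4 + 1) + 1 := by
      exact_mod_cast hN
    simp only [Polynomial.eval_add, Polynomial.eval_mul, Polynomial.eval_C,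
      Polynomial.eval_X, Polynomial.eval_one]
    calc (N : ℝ) ≤ 3 * (2 * Nat.log 2 B + 4) * (2 * Nat.log 2 B + 4 + 1) + 1 := hN'
      _ ≤ 3 * (2 * (2 * Real.log B) + 4) * (2 * (2 * Real.log B) + 4 + 1) + 1 := by gcongr
      _ = _ := by ring
  exact ⟨h1, hbound _ h2, fun i => hbound _ (h3 i)⟩
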